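/- Let $k \ge 1$ be fixed and let $P = (p_1,\dots,p_k)$ be a probability vector with $p_i > 0$ for all $i$. For each $n$ let $\hat P^{\mathsf{Poi}}_{n,k} = (\hat p_1,\dots,\hat p_k)$, where $\hat p_1,\dots,\hat p_k$ are independent random variables and $\hat p_i$ is distributed as $\mathsf{Poi}(np_i)/n$, with $\mathsf{Poi}(\lambda)$ a Poisson random variable with parameter $\lambda$. Put $$D(\hat P^{\mathsf{Poi}}_{n,k}\|P) = \sum_{i=1}^k \hat p_i \log\frac{\hat p_i}{p_i},$$ where $\log$ is the natural logarithm and $0\log 0 = 0$. Then, as $n \to \infty$, $$\sqrt n\, D(\hat P^{\mathsf{Poi}}_{n,k}\|P) \xrightarrow{\mathcal D} \mathcal N(0,1).$$ Moreover $D(\hat P^{\mathsf{Poi}}_{n,k}\|P)$ has a finite second moment for every $n$, the limit $\lim_{n\to\infty} n\,\mathsf{Var}\big[D(\hat P^{\mathsf{Poi}}_{n,k}\|P)\big]$ exists and is finite, and $$1 \le \lim_{n\to\infty} n\,\mathsf{Var}\big[D(\hat P^{\mathsf{Poi}}_{n,k}\|P)\big].$$ -/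

import Mathlib

open MeasureTheory ProbabilityTheory Filter Topology

/-- The quantity `D(Q‖P) = ∑ i, q_i log (q_i / p_i)` with the natural logarithm, for a real vector
`q` with nonnegative entries (not necessarily of total mass one) and a vector `p` with positive
entries. A term with `q_i = 0` is `0`, which is the usual convention `0 log 0 = 0`. -/
noncomputable def relEntropy {k : ℕ} (q p : Fin k → ℝ) : ℝ :=
  ∑ i, q i * Real.log (q i / p i)

/-- The law of `Poi(n a) / n`, for `a ≥ 0`: the image of the Poisson distribution with parameter
`n a` under `m ↦ m / n`. -/
noncomputable def scaledPoisson (n : ℕ) (a : ℝ) : Measure ℝ :=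
  (poissonMeasure (Real.toNNReal (n * a))).map (fun m : ℕ => (m : ℝ) / (n : ℝ))

/-! Write `x log (x / a) = (x - a) + R_a(x)`. Summed over coordinates, the relative entropy is a
linear term `S = ∑ (q_i - p_i)` plus a remainder. The Poissonized vector need not have mass one, so
`S` does not cancel; it dominates. Since `∑ p_i = 1`, `S` is a centred Poisson variable of parameter
`n` divided by `n`: its variance is `1 / n`, and the characteristic function of `√n S` is explicit
and tends to `exp (-t² / 2)`. On `x ≥ 0` one has `0 ≤ R_a(x) ≤ (x - a)² / a`, so the second and
fourth Poisson moments give the remainder mean `O(1/n)` and variance `O(1/n²)`. It therefore affects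
neither limit, by `norm_charFun_map_add_sub_le` and `tendsto_mul_variance_add`. -/

/-! ### Central moments of the Poisson distribution -/

theorem integrable_exp_natCast_poissonMeasure (r : NNReal) :
    Integrable (fun m : ℕ => Real.exp m) (poissonMeasure r) := by
  rw [integrable_poissonMeasure_iff]
  have h := (Real.summable_pow_div_factorial (r * Real.exp 1)).mul_left (Real.exp (-r))
  refine h.congr fun m => ?_
  rw [Real.norm_of_nonneg (Real.exp_pos _).le, mul_pow, ← Real.exp_nat_mul, mul_one]
  ring

theorem integrable_natCast_pow_poissonMeasure (r : NNReal) (j : ℕ) :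
    Integrable (fun m : ℕ => (m : ℝ) ^ j) (poissonMeasure r) := by
  refine ((integrable_exp_natCast_poissonMeasure r).const_mul (j.factorial : ℝ)).mono'
    .of_discrete (ae_of_all _ fun m => ?_)
  have h := Real.pow_div_factorial_le_exp (m : ℝ) (by positivity) j
  rw [div_le_iff₀ (by positivity)] at h
  rw [Real.norm_of_nonneg (by positivity)]
  linarith

open Polynomial in
theorem integrable_polynomial_poissonMeasure (r : NNReal) (P : ℝ[X]) :
    Integrable (fun m : ℕ => P.eval (m : ℝ)) (poissonMeasure r) := by
  simp_rw [Polynomial.eval_eq_sum_range]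
  exact integrable_finsetSum _ fun i _ =>
    (integrable_natCast_pow_poissonMeasure r i).const_mul _

theorem integrable_affine_pow_poissonMeasure (r : NNReal) (a b : ℝ) (j : ℕ) :
    Integrable (fun m : ℕ => (a * m + b) ^ j) (poissonMeasure r) := by
  exact (integrable_polynomial_poissonMeasure r
    ((Polynomial.C a * Polynomial.X + Polynomial.C b) ^ j)).congr
      (ae_of_all _ fun m => by simp)

/-- The Stein–Chen identity for the Poisson distribution. -/
theorem integral_natCast_mul_poissonMeasure (r : NNReal) (g : ℕ → ℝ)
    (hg : Integrable (fun m : ℕ => (m : ℝ) * g m) (poissonMeasure r)) :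
    ∫ m, (m : ℝ) * g m ∂poissonMeasure r = r * ∫ m, g (m + 1) ∂poissonMeasure r := by
  rw [integral_poissonMeasure, integral_poissonMeasure, ← tsum_mul_left,
    (hasSum_integral_poissonMeasure hg).summable.tsum_eq_zero_add]
  simp only [Nat.cast_zero, zero_mul, smul_eq_mul, mul_zero, zero_add]
  refine tsum_congr fun m => ?_
  rw [Nat.factorial_succ]
  push_cast
  field_simp
  ring

/-- Split off one factor `m - r` and apply Stein–Chen to the `m` part. The `j`-th powers cancel on
the right, leaving a recursion in lower moments. -/
theorem integral_centered_pow_succ_poissonMeasure (r : NNReal) (j : ℕ) :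
    ∫ m : ℕ, ((m : ℝ) - r) ^ (j + 1) ∂poissonMeasure r
      = r * ∫ m : ℕ, (((m : ℝ) - r + 1) ^ j - ((m : ℝ) - r) ^ j) ∂poissonMeasure r := by
  have hi (b : ℝ) : Integrable (fun m : ℕ => ((m : ℝ) + b) ^ j) (poissonMeasure r) := by
    simpa using integrable_affine_pow_poissonMeasure r 1 b j
  have hj : Integrable (fun m : ℕ => (m : ℝ) * ((m : ℝ) - r) ^ j) (poissonMeasure r) := by
    exact (integrable_polynomial_poissonMeasure r
      (Polynomial.X * (Polynomial.X - Polynomial.C (r : ℝ)) ^ j)).congr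
        (ae_of_all _ fun m => by simp)
  have h0 : Integrable (fun m : ℕ => ((m : ℝ) - r) ^ j) (poissonMeasure r) := by
    simpa [sub_eq_add_neg] using hi (-r)
  have h1 : Integrable (fun m : ℕ => ((m : ℝ) - r + 1) ^ j) (poissonMeasure r) := by
    simpa [sub_eq_add_neg, add_assoc] using hi (-r + 1)
  have hs := integral_natCast_mul_poissonMeasure r (fun m => ((m : ℝ) - r) ^ j) hj
  have he : ∀ m : ℕ, ((m : ℝ) - r) ^ (j + 1)
      = (m : ℝ) * ((m : ℝ) - r) ^ j - r * ((m : ℝ) - r) ^ j := fun m => by ring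
  simp_rw [he]
  rw [integral_sub hj (h0.const_mul _), integral_sub h1 h0, integral_const_mul, hs, mul_sub]
  congr 3
  ext m
  push_cast
  ring

theorem integral_centered_poissonMeasure (r : NNReal) :
    ∫ m : ℕ, ((m : ℝ) - r) ∂poissonMeasure r = 0 := by
  simpa using integral_centered_pow_succ_poissonMeasure r 0

theorem integral_centered_sq_poissonMeasure (r : NNReal) :
    ∫ m : ℕ, ((m : ℝ) - r) ^ 2 ∂poissonMeasure r = r := by
  simpa using integral_centered_pow_succ_poissonMeasure r 1

theorem integrable_centered_pow_poissonMeasure (r : NNReal) (j : ℕ) :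
    Integrable (fun m : ℕ => ((m : ℝ) - r) ^ j) (poissonMeasure r) := by
  simpa [sub_eq_add_neg] using integrable_affine_pow_poissonMeasure r 1 (-r) j

theorem integral_centered_pow_four_poissonMeasure (r : NNReal) :
    ∫ m : ℕ, ((m : ℝ) - r) ^ 4 ∂poissonMeasure r = 3 * r ^ 2 + r := by
  have h1 := integrable_centered_pow_poissonMeasure r 1
  have h2 := integrable_centered_pow_poissonMeasure r 2
  simp only [pow_one] at h1
  rw [integral_centered_pow_succ_poissonMeasure]
  have he : ∀ m : ℕ, ((m : ℝ) - r + 1) ^ 3 - ((m : ℝ) - r) ^ 3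
      = 3 * ((m : ℝ) - r) ^ 2 + 3 * ((m : ℝ) - r) + 1 := fun m => by ring
  simp_rw [he]
  have h21 : Integrable (fun m : ℕ => 3 * ((m : ℝ) - r) ^ 2 + 3 * ((m : ℝ) - r))
      (poissonMeasure r) := (h2.const_mul 3).add (h1.const_mul 3)
  rw [integral_add h21 (integrable_const _),
    integral_add (h2.const_mul 3) (h1.const_mul 3), integral_const_mul, integral_const_mul,
    integral_centered_poissonMeasure, integral_centered_sq_poissonMeasure]
  simp
  ring

/-! ### Moments and characteristic function of the scaled law -/

instance isProbabilityMeasure_scaledPoisson (n : ℕ) (a : ℝ) :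
    IsProbabilityMeasure (scaledPoisson n a) :=
  Measure.isProbabilityMeasure_map .of_discrete

theorem ae_nonneg_scaledPoisson (n : ℕ) (a : ℝ) : ∀ᵐ x ∂scaledPoisson n a, 0 ≤ x := by
  rw [scaledPoisson, ae_map_iff .of_discrete measurableSet_Ici]
  exact ae_of_all _ fun m => by positivity

theorem integrable_sub_pow_scaledPoisson (n : ℕ) (a : ℝ) (j : ℕ) :
    Integrable (fun x => (x - a) ^ j) (scaledPoisson n a) := by
  rw [scaledPoisson, integrable_map_measure (by fun_prop) .of_discrete]
  simpa [Function.comp_def, div_eq_inv_mul, sub_eq_add_neg] using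
    integrable_affine_pow_poissonMeasure (n * a).toNNReal (n : ℝ)⁻¹ (-a) j

theorem integral_sub_pow_scaledPoisson {n : ℕ} (hn : n ≠ 0) {a : ℝ} (ha : 0 ≤ a) (j : ℕ) :
    ∫ x, (x - a) ^ j ∂scaledPoisson n a = ((n : ℝ) ^ j)⁻¹ *
      ∫ m : ℕ, ((m : ℝ) - (n * a).toNNReal) ^ j ∂poissonMeasure (n * a).toNNReal := by
  have hn' : (n : ℝ) ≠ 0 := by exact_mod_cast hn
  rw [scaledPoisson, integral_map .of_discrete (by fun_prop), ← integral_const_mul]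
  congr 1 with m
  rw [Real.coe_toNNReal _ (by positivity), ← inv_pow, ← mul_pow]
  congr 1
  field_simp

theorem integral_sub_sq_scaledPoisson {n : ℕ} (hn : n ≠ 0) {a : ℝ} (ha : 0 ≤ a) :
    ∫ x, (x - a) ^ 2 ∂scaledPoisson n a = a / n := by
  have hn' : (n : ℝ) ≠ 0 := by exact_mod_cast hn
  rw [integral_sub_pow_scaledPoisson hn ha, integral_centered_sq_poissonMeasure,
    Real.coe_toNNReal _ (by positivity)]
  field_simp

theorem integral_sub_pow_four_scaledPoisson {n : ℕ} (hn : n ≠ 0) {a : ℝ} (ha : 0 ≤ a) :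
    ∫ x, (x - a) ^ 4 ∂scaledPoisson n a = 3 * a ^ 2 / n ^ 2 + a / n ^ 3 := by
  have hn' : (n : ℝ) ≠ 0 := by exact_mod_cast hn
  rw [integral_sub_pow_scaledPoisson hn ha, integral_centered_pow_four_poissonMeasure,
    Real.coe_toNNReal _ (by positivity)]
  field_simp

theorem integral_sub_scaledPoisson {n : ℕ} (hn : n ≠ 0) {a : ℝ} (ha : 0 ≤ a) :
    ∫ x, (x - a) ∂scaledPoisson n a = 0 := by
  have h := integral_sub_pow_scaledPoisson hn ha 1
  simpa only [pow_one, integral_centered_poissonMeasure, mul_zero] using h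

theorem memLp_sub_scaledPoisson (n : ℕ) (a : ℝ) :
    MemLp (fun x => x - a) 2 (scaledPoisson n a) :=
  (memLp_two_iff_integrable_sq (by fun_prop)).2 (integrable_sub_pow_scaledPoisson n a 2)

theorem variance_sub_scaledPoisson {n : ℕ} (hn : n ≠ 0) {a : ℝ} (ha : 0 ≤ a) :
    variance (fun x => x - a) (scaledPoisson n a) = a / n := by
  rw [variance_of_integral_eq_zero (by fun_prop) (integral_sub_scaledPoisson hn ha)]
  exact integral_sub_sq_scaledPoisson hn ha

open Complex in
theorem charFun_scaledPoisson {n : ℕ} {a : ℝ} (ha : 0 ≤ a) (t : ℝ) :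
    charFun (scaledPoisson n a) t = cexp (n * a * (cexp (t / n * I) - 1)) := by
  have h := charFun_map_cast_poissonMeasure (n * a).toNNReal (t / n)
  rw [scaledPoisson]
  rw [charFun_apply, integral_map .of_discrete (by fun_prop)] at h ⊢
  rw [Real.coe_toNNReal _ (by positivity)] at h
  push_cast at h
  rw [← h]
  congr 1 with m
  simp only [Real.inner_apply]
  congr 3
  ring

/-! ### Quadratic control of the entropy remainder -/

/-- The second-order remainder of `x ↦ x log (x / a)` at `x = a`. -/
noncomputable def entropyRemainder (a x : ℝ) : ℝ :=
  x * Real.log (x / a) - (x - a)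

@[fun_prop]
theorem measurable_entropyRemainder (a : ℝ) : Measurable (entropyRemainder a) := by
  unfold entropyRemainder
  fun_prop

theorem entropyRemainder_nonneg {a x : ℝ} (ha : 0 < a) (hx : 0 ≤ x) :
    0 ≤ entropyRemainder a x := by
  have h := InformationTheory.klFun_nonneg (x := x / a) (by positivity)
  have : entropyRemainder a x = a * InformationTheory.klFun (x / a) := by
    rw [entropyRemainder, InformationTheory.klFun]
    field_simp
    ring
  rw [this]
  positivity

/-- Use `log u ≤ u - 1` at `u = x / a`; the resulting upper bound is exactly the square. -/
theorem entropyRemainder_le {a x : ℝ} (ha : 0 < a) (hx : 0 ≤ x) :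
    entropyRemainder a x ≤ (x - a) ^ 2 / a := by
  have h : x * Real.log (x / a) ≤ x * (x / a - 1) := by
    rcases hx.eq_or_lt with rfl | hx
    · simp
    · exact mul_le_mul_of_nonneg_left (Real.log_le_sub_one_of_pos (by positivity)) hx.le
  calc entropyRemainder a x ≤ x * (x / a - 1) - (x - a) := sub_le_sub_right h _
    _ = (x - a) ^ 2 / a := by field_simp

theorem relEntropy_eq_add {k : ℕ} (q p : Fin k → ℝ) :
    relEntropy q p = ∑ i, (q i - p i) + ∑ i, entropyRemainder (p i) (q i) := by
  rw [relEntropy, ← Finset.sum_add_distrib]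
  exact Finset.sum_congr rfl fun i _ => by rw [entropyRemainder]; ring

theorem memLp_entropyRemainder (n : ℕ) {a : ℝ} (ha : 0 < a) :
    MemLp (entropyRemainder a) 2 (scaledPoisson n a) := by
  have h : MemLp (fun x => (x - a) ^ 2 / a) 2 (scaledPoisson n a) := by
    rw [memLp_two_iff_integrable_sq (by fun_prop)]
    refine ((integrable_sub_pow_scaledPoisson n a 4).div_const (a ^ 2)).congr
      (ae_of_all _ fun x => ?_)
    ring
  refine h.mono (by fun_prop) ?_
  filter_upwards [ae_nonneg_scaledPoisson n a] with x hx
  rw [Real.norm_of_nonneg (entropyRemainder_nonneg ha hx), Real.norm_of_nonneg (by positivity)]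
  exact entropyRemainder_le ha hx

theorem integral_abs_entropyRemainder_le {n : ℕ} (hn : n ≠ 0) {a : ℝ} (ha : 0 < a) :
    ∫ x, |entropyRemainder a x| ∂scaledPoisson n a ≤ (n : ℝ)⁻¹ := by
  calc ∫ x, |entropyRemainder a x| ∂scaledPoisson n a
      ≤ ∫ x, (x - a) ^ 2 / a ∂scaledPoisson n a := by
        refine integral_mono_ae ((memLp_entropyRemainder n ha).integrable (by simp)).abs
          ((integrable_sub_pow_scaledPoisson n a 2).div_const a) ?_
        filter_upwards [ae_nonneg_scaledPoisson n a] with x hx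
        rw [abs_of_nonneg (entropyRemainder_nonneg ha hx)]
        exact entropyRemainder_le ha hx
    _ = (n : ℝ)⁻¹ := by
        rw [integral_div, integral_sub_sq_scaledPoisson hn ha.le]
        field_simp

theorem variance_entropyRemainder_le {n : ℕ} (hn : n ≠ 0) {a : ℝ} (ha : 0 < a) :
    variance (entropyRemainder a) (scaledPoisson n a) ≤ (3 + a⁻¹) / n ^ 2 := by
  have hn' : (1 : ℝ) ≤ n := by exact_mod_cast Nat.one_le_iff_ne_zero.2 hn
  calc variance (entropyRemainder a) (scaledPoisson n a)
      ≤ ∫ x, entropyRemainder a x ^ 2 ∂scaledPoisson n a :=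
        variance_le_expectation_sq (by fun_prop)
    _ ≤ ∫ x, (x - a) ^ 4 / a ^ 2 ∂scaledPoisson n a := by
        refine integral_mono_ae (memLp_entropyRemainder n ha).integrable_sq
          ((integrable_sub_pow_scaledPoisson n a 4).div_const _) ?_
        filter_upwards [ae_nonneg_scaledPoisson n a] with x hx
        calc entropyRemainder a x ^ 2 ≤ ((x - a) ^ 2 / a) ^ 2 :=
              pow_le_pow_left₀ (entropyRemainder_nonneg ha hx) (entropyRemainder_le ha hx) 2
          _ = (x - a) ^ 4 / a ^ 2 := by ring
    _ = 3 / n ^ 2 + a⁻¹ / n ^ 3 := by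
        rw [integral_div, integral_sub_pow_four_scaledPoisson hn ha.le]
        field_simp
    _ ≤ 3 / n ^ 2 + a⁻¹ / n ^ 2 := by
        -- `n ^ 2 ≤ n ^ 3` needs `1 ≤ n`.
        gcongr
        norm_num
    _ = (3 + a⁻¹) / n ^ 2 := by ring

/-! ### Characteristic function estimates -/

-- Factor out `exp (i t X)`, of modulus one, and use `|exp (i u) - 1| ≤ |u|`. No independence of `X`
-- and `Y` is needed.
open Complex in
theorem norm_charFun_map_add_sub_le {Ω : Type*} [MeasurableSpace Ω] {μ : Measure Ω}
    [IsProbabilityMeasure μ] {X Y : Ω → ℝ} (hX : AEMeasurable X μ) (hY : Integrable Y μ) (t : ℝ) :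
    ‖charFun (μ.map fun ω => X ω + Y ω) t - charFun (μ.map X) t‖ ≤ |t| * ∫ ω, |Y ω| ∂μ := by
  have hXY : AEMeasurable (fun ω => X ω + Y ω) μ := hX.add hY.aemeasurable
  have hint {Z : Ω → ℝ} (hZ : AEMeasurable Z μ) : Integrable (fun ω => cexp (t * Z ω * I)) μ := by
    refine Integrable.of_bound (by fun_prop) 1 (ae_of_all _ fun ω => ?_)
    rw [← ofReal_mul, norm_exp_ofReal_mul_I]
  rw [charFun_apply_real, charFun_apply_real, integral_map hXY (by fun_prop),
    integral_map hX (by fun_prop), ← integral_sub (hint hXY) (hint hX), ← integral_const_mul]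
  refine norm_integral_le_of_norm_le (hY.abs.const_mul _) (ae_of_all _ fun ω => ?_)
  have he : cexp (t * (X ω + Y ω : ℝ) * I) - cexp (t * X ω * I)
      = cexp ((t * X ω : ℝ) * I) * (cexp (I * (t * Y ω : ℝ)) - 1) := by
    rw [mul_sub, ← Complex.exp_add]
    push_cast
    ring_nf
  rw [he, norm_mul, norm_exp_ofReal_mul_I, one_mul, ← abs_mul]
  exact Real.norm_exp_I_mul_ofReal_sub_one_le

open Complex in
theorem tendsto_mul_exp_sub_one_sub (t : ℝ) :
    Tendsto (fun n : ℕ => (n : ℂ) * (cexp ((t / √n : ℝ) * I) - 1 - (t / √n : ℝ) * I)) atTop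
      (𝓝 (-(t ^ 2 / 2))) := by
  have hs : Tendsto (fun n : ℕ => √(n : ℝ)) atTop atTop :=
    Real.tendsto_sqrt_atTop.comp tendsto_natCast_atTop_atTop
  have hw : Tendsto (fun n : ℕ => |t| ^ 3 / √(n : ℝ)) atTop (𝓝 0) := hs.const_div_atTop _
  have hw1 : Tendsto (fun n : ℕ => |t| / √(n : ℝ)) atTop (𝓝 0) := hs.const_div_atTop _
  rw [tendsto_iff_norm_sub_tendsto_zero]
  refine squeeze_zero' (Eventually.of_forall fun _ => norm_nonneg _) ?_ hw
  filter_upwards [eventually_ge_atTop 1, hw1.eventually_le_const one_pos] with n hn hle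
  have hn0 : (0 : ℝ) < n := by exact_mod_cast hn
  have hsn : 0 < √(n : ℝ) := Real.sqrt_pos.2 hn0
  set w : ℝ := t / √n with hwd
  have hnorm : ‖(w : ℂ) * I‖ = |t| / √n := by
    rw [norm_mul, norm_I, mul_one, norm_real, Real.norm_eq_abs, hwd, abs_div, abs_of_pos hsn]
  have hnw : (n : ℂ) * (w : ℂ) ^ 2 = (t : ℂ) ^ 2 := by
    have : (n : ℝ) * w ^ 2 = t ^ 2 := by
      rw [hwd, div_pow, Real.sq_sqrt hn0.le]
      field_simp
    exact_mod_cast this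
  have hb := Complex.exp_bound (x := w * I) (hnorm.trans_le hle) (n := 3) (by norm_num)
  have he : (n : ℂ) * (cexp (w * I) - 1 - w * I) - -((t : ℂ) ^ 2 / 2)
      = n * (cexp (w * I) - ∑ m ∈ Finset.range 3, (w * I) ^ m / m.factorial) := by
    rw [← hnw]
    simp only [Finset.sum_range_succ, Finset.sum_range_zero, mul_pow, I_sq, Nat.factorial]
    push_cast
    ring
  rw [he, norm_mul, norm_natCast]
  rw [hnorm] at hb
  calc (n : ℝ) * ‖cexp (w * I) - ∑ m ∈ Finset.range 3, (w * I) ^ m / m.factorial‖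
      ≤ n * ((|t| / √n) ^ 3 * 1) := by
        gcongr
        refine hb.trans ?_
        gcongr
        -- The Taylor bound has constant `4 / (3! * 3) = 2 / 9`, relaxed to `1`.
        norm_num [Nat.factorial]
    _ = |t| ^ 3 / √n := by
        have h2 : (n : ℝ) = √n ^ 2 := (Real.sq_sqrt hn0.le).symm
        rw [div_pow, mul_one, pow_succ (√(n : ℝ)) 2, ← h2]
        field_simp

open Complex in
theorem ProbabilityTheory.HasLaw.charFun_map_sub_scaledPoisson {Ω : Type*} [MeasurableSpace Ω] {μ : Measure Ω}
    {n : ℕ} {a : ℝ} (ha : 0 ≤ a) {X : Ω → ℝ} (hX : HasLaw X (scaledPoisson n a) μ) (t : ℝ) :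
    charFun (μ.map fun ω => X ω - a) t = cexp (a * (n * (cexp (t / n * I) - 1) - t * I)) := by
  have h : charFun (μ.map fun ω => X ω - a) t = charFun (μ.map X) t * cexp (-(t * a) * I) := by
    have := hX.aemeasurable
    rw [charFun_apply_real, charFun_apply_real, integral_map (by fun_prop) (by fun_prop),
      integral_map (by fun_prop) (by fun_prop), ← integral_mul_const]
    congr 1 with ω
    rw [← Complex.exp_add]
    push_cast
    ring_nf
  rw [h, hX.map_eq, charFun_scaledPoisson ha, ← Complex.exp_add]
  congr 1
  ring

/-! ### Variance of sums -/

/-- The quadratic `x ↦ Var (X + x Y)` is nonnegative, so its discriminant is nonpositive. -/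
theorem covariance_sq_le {Ω : Type*} [MeasurableSpace Ω] {μ : Measure Ω} [IsFiniteMeasure μ]
    {X Y : Ω → ℝ} (hX : MemLp X 2 μ) (hY : MemLp Y 2 μ) :
    covariance X Y μ ^ 2 ≤ variance X μ * variance Y μ := by
  have h (x : ℝ) : 0 ≤ variance Y μ * (x * x) + 2 * covariance X Y μ * x + variance X μ := by
    have hv := variance_nonneg (X + x • Y) μ
    rw [variance_add hX (hY.const_smul x), variance_smul, covariance_smul_right] at hv
    linarith
  have hd := discrim_le_zero h
  rw [discrim] at hd
  linarith

/-- By Cauchy–Schwarz the squared scaled covariance is at most `(a Var X) (a Var Y)`, which tends to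
`v * 0`. -/
theorem tendsto_mul_variance_add {Ω : ℕ → Type*} [∀ n, MeasurableSpace (Ω n)]
    {μ : ∀ n, Measure (Ω n)} [∀ n, IsProbabilityMeasure (μ n)] {X Y : ∀ n, Ω n → ℝ} {a : ℕ → ℝ}
    {v : ℝ} (hX : ∀ n, MemLp (X n) 2 (μ n)) (hY : ∀ n, MemLp (Y n) 2 (μ n))
    (hXv : Tendsto (fun n => a n * variance (X n) (μ n)) atTop (𝓝 v))
    (hYv : Tendsto (fun n => a n * variance (Y n) (μ n)) atTop (𝓝 0)) :
    Tendsto (fun n => a n * variance (fun ω => X n ω + Y n ω) (μ n)) atTop (𝓝 v) := by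
  have hc : Tendsto (fun n => a n * covariance (X n) (Y n) (μ n)) atTop (𝓝 0) := by
    have hsq : Tendsto (fun n => (a n * covariance (X n) (Y n) (μ n)) ^ 2) atTop (𝓝 0) := by
      refine squeeze_zero (fun n => sq_nonneg _) (fun n => ?_)
        (by simpa using hXv.mul hYv)
      have := mul_le_mul_of_nonneg_left (covariance_sq_le (hX n) (hY n)) (sq_nonneg (a n))
      linarith
    have := hsq.sqrt
    simp only [Real.sqrt_sq_eq_abs, Real.sqrt_zero] at this
    exact (tendsto_zero_iff_abs_tendsto_zero _).2 this
  have h := (hXv.add (hc.const_mul 2)).add hYv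
  simp only [mul_zero, add_zero] at h
  refine h.congr fun n => ?_
  rw [variance_fun_add (hX n) (hY n)]
  ring

theorem ProbabilityTheory.HasLaw.memLp_comp {Ω E : Type*} [MeasurableSpace Ω] [MeasurableSpace E] {μ : Measure Ω}
    {ν : Measure E} {X : Ω → E} (hX : HasLaw X ν μ) {f : E → ℝ} {q : ENNReal} (hf : MemLp f q ν) :
    MemLp (fun ω => f (X ω)) q μ :=
  MemLp.comp_of_map (hX.map_eq.symm ▸ hf) hX.aemeasurable

theorem ProbabilityTheory.HasLaw.variance_fun_comp {Ω E : Type*} [MeasurableSpace Ω] [MeasurableSpace E]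
    {μ : Measure Ω} {ν : Measure E} {X : Ω → E} (hX : HasLaw X ν μ) {f : E → ℝ}
    (hf : AEMeasurable f ν) : variance (fun ω => f (X ω)) μ = variance f ν := by
  rw [← hX.map_eq, variance_map (hX.map_eq ▸ hf) hX.aemeasurable, Function.comp_def]

theorem ProbabilityTheory.iIndepFun.variance_sum_comp {Ω ι : Type*} [Fintype ι] [MeasurableSpace Ω] {μ : Measure Ω}
    [IsProbabilityMeasure μ] {X : ι → Ω → ℝ} {ν : ι → Measure ℝ} (hX : ∀ i, HasLaw (X i) (ν i) μ)
    (hind : iIndepFun X μ) {f : ι → ℝ → ℝ} (hf : ∀ i, Measurable (f i))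
    (hf2 : ∀ i, MemLp (f i) 2 (ν i)) :
    variance (fun ω => ∑ i, f i (X i ω)) μ = ∑ i, variance (f i) (ν i) := by
  have h := IndepFun.variance_sum (μ := μ) (s := Finset.univ) (X := fun i ω => f i (X i ω))
    (fun i _ => HasLaw.memLp_comp (hX i) (hf2 i))
    (fun i _ j _ hij => (hind.comp f hf).indepFun hij)
  have he : (fun ω => ∑ i, f i (X i ω)) = ∑ i, fun ω => f i (X i ω) := by
    ext ω
    simp
  rw [he, h]
  exact Finset.sum_congr rfl fun i _ =>
    HasLaw.variance_fun_comp (hX i) (hf i).aemeasurable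

/-! ### Linear term and remainder for the Poissonized vector -/

section ScaledPoissonVector

variable {k : ℕ} {p : Fin k → ℝ} {Ω : Type*} [MeasurableSpace Ω] {μ : Measure Ω}
  {q : Fin k → Ω → ℝ} {n : ℕ}

theorem memLp_sum_sub (hq : ∀ i, HasLaw (q i) (scaledPoisson n (p i)) μ) :
    MemLp (fun ω => ∑ i, (q i ω - p i)) 2 μ :=
  memLp_finsetSum _ fun i _ => HasLaw.memLp_comp (hq i) (memLp_sub_scaledPoisson n (p i))

theorem memLp_sum_entropyRemainder (hp : ∀ i, 0 < p i)
    (hq : ∀ i, HasLaw (q i) (scaledPoisson n (p i)) μ) :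
    MemLp (fun ω => ∑ i, entropyRemainder (p i) (q i ω)) 2 μ :=
  memLp_finsetSum _ fun i _ => HasLaw.memLp_comp (hq i) (memLp_entropyRemainder n (hp i))

theorem variance_sum_sub [IsProbabilityMeasure μ] (hn : n ≠ 0) (hp : ∀ i, 0 < p i)
    (hsum : ∑ i, p i = 1)
    (hq : ∀ i, HasLaw (q i) (scaledPoisson n (p i)) μ) (hind : iIndepFun q μ) :
    variance (fun ω => ∑ i, (q i ω - p i)) μ = (n : ℝ)⁻¹ := by
  rw [iIndepFun.variance_sum_comp (f := fun i x => x - p i) hq hind (by fun_prop)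
    fun i => memLp_sub_scaledPoisson n (p i)]
  simp_rw [variance_sub_scaledPoisson hn (hp _).le]
  rw [← Finset.sum_div, hsum, one_div]

theorem variance_sum_entropyRemainder_le [IsProbabilityMeasure μ] (hn : n ≠ 0) (hp : ∀ i, 0 < p i)
    (hq : ∀ i, HasLaw (q i) (scaledPoisson n (p i)) μ) (hind : iIndepFun q μ) :
    variance (fun ω => ∑ i, entropyRemainder (p i) (q i ω)) μ
      ≤ (∑ i, (3 + (p i)⁻¹)) / n ^ 2 := by
  rw [iIndepFun.variance_sum_comp hq hind (fun i => measurable_entropyRemainder (p i))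
    fun i => memLp_entropyRemainder n (hp i), Finset.sum_div]
  exact Finset.sum_le_sum fun i _ => variance_entropyRemainder_le hn (hp i)

theorem integral_abs_sum_entropyRemainder_le [IsProbabilityMeasure μ] (hn : n ≠ 0) (hp : ∀ i, 0 < p i)
    (hq : ∀ i, HasLaw (q i) (scaledPoisson n (p i)) μ) :
    ∫ ω, |∑ i, entropyRemainder (p i) (q i ω)| ∂μ ≤ k / n := by
  have hint (i : Fin k) : Integrable (fun ω => |entropyRemainder (p i) (q i ω)|) μ :=
    ((HasLaw.memLp_comp (hq i) (memLp_entropyRemainder n (hp i))).integrable (by simp)).abs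
  calc ∫ ω, |∑ i, entropyRemainder (p i) (q i ω)| ∂μ
      ≤ ∫ ω, ∑ i, |entropyRemainder (p i) (q i ω)| ∂μ :=
        integral_mono ((memLp_sum_entropyRemainder hp hq).integrable (by simp)).abs
          (integrable_finsetSum _ fun i _ => hint i) fun ω => Finset.abs_sum_le_sum_abs _ _
    _ = ∑ i, ∫ x, |entropyRemainder (p i) x| ∂scaledPoisson n (p i) := by
        rw [integral_finsetSum _ fun i _ => hint i]
        refine Finset.sum_congr rfl fun i _ => ?_
        exact (hq i).integral_comp (f := fun x => |entropyRemainder (p i) x|)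
          (measurable_entropyRemainder (p i)).abs.aestronglyMeasurable
    _ ≤ ∑ _i : Fin k, (n : ℝ)⁻¹ :=
        Finset.sum_le_sum fun i _ => integral_abs_entropyRemainder_le hn (hp i)
    _ = k / n := by simp [div_eq_mul_inv]

-- Independence adds the exponents, and `∑ p_i = 1` removes all dependence on `k` and `p`.
open Complex in
theorem charFun_map_sqrt_mul_sum_sub (hn : n ≠ 0) (hp : ∀ i, 0 < p i) (hsum : ∑ i, p i = 1)
    (hq : ∀ i, HasLaw (q i) (scaledPoisson n (p i)) μ) (hind : iIndepFun q μ) (t : ℝ) :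
    charFun (μ.map fun ω => √(n : ℝ) * ∑ i, (q i ω - p i)) t
      = cexp (n * (cexp ((t / √n : ℝ) * I) - 1 - (t / √n : ℝ) * I)) := by
  have hm (i : Fin k) : AEMeasurable (fun ω => q i ω - p i) μ :=
    (hq i).aemeasurable.sub_const _
  have hn0 : (0 : ℝ) < n := by exact_mod_cast Nat.pos_of_ne_zero hn
  have hsn : √(n : ℝ) ≠ 0 := (Real.sqrt_pos.2 hn0).ne'
  have hind' : iIndepFun (fun i ω => q i ω - p i) μ :=
    hind.comp (fun i x => x - p i) (by fun_prop)
  rw [charFun_map_mul_comp (Finset.aemeasurable_fun_sum _ fun i _ => hm i),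
    hind'.charFun_map_fun_sum_eq_prod hm, Finset.prod_apply]
  simp_rw [HasLaw.charFun_map_sub_scaledPoisson (hp _).le (hq _)]
  rw [← Complex.exp_sum, ← Finset.sum_mul]
  have hsum' : ∑ i, (p i : ℂ) = 1 := by exact_mod_cast hsum
  have h1 : √(n : ℝ) * t = n * (t / √n) := by
    nth_rewrite 2 [← Real.sq_sqrt hn0.le]
    field_simp
  have hn1 : (n : ℂ) ≠ 0 := by exact_mod_cast hn
  rw [hsum', one_mul, h1]
  congr 1
  push_cast
  rw [mul_div_cancel_left₀ _ hn1]
  ring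

end ScaledPoissonVector

theorem theorem2 {k : ℕ} (p : Fin k → ℝ) (hp_pos : ∀ i, 0 < p i) (hp_sum : ∑ i, p i = 1)
    {Ω : ℕ → Type*} [∀ n, MeasurableSpace (Ω n)]
    (μ : ∀ n, Measure (Ω n)) [∀ n, IsProbabilityMeasure (μ n)]
    (phat : ∀ n, Fin k → Ω n → ℝ)
    (h_law : ∀ n i, HasLaw (phat n i) (scaledPoisson n (p i)) (μ n))
    (h_indep : ∀ n, iIndepFun (phat n) (μ n)) :
    TendstoInDistribution
        (fun (n : ℕ) (ω : Ω n) => √(n : ℝ) * relEntropy (fun i => phat n i ω) p) atTop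
        (id : ℝ → ℝ) μ (gaussianReal 0 1) ∧
      (∀ n, MemLp (fun ω => relEntropy (fun i => phat n i ω) p) 2 (μ n)) ∧
      ∃ L : ℝ,
        Tendsto (fun n : ℕ => (n : ℝ) * variance (fun ω => relEntropy (fun i => phat n i ω) p) (μ n))
          atTop (𝓝 L) ∧
        1 ≤ L := by
  simp_rw [relEntropy_eq_add]
  have hS n := memLp_sum_sub (h_law n)
  have hR n := memLp_sum_entropyRemainder hp_pos (h_law n)
  have hs : Tendsto (fun n : ℕ => √(n : ℝ)) atTop atTop :=
    Real.tendsto_sqrt_atTop.comp tendsto_natCast_atTop_atTop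
  -- The limiting variance is exactly `1`, so the lower bound is an equality.
  refine ⟨⟨fun n => ((hS n).aemeasurable.add (hR n).aemeasurable).const_mul _,
    aemeasurable_id, ?_⟩, fun n => (hS n).add (hR n), 1, ?_, le_rfl⟩
  -- Lévy continuity: the linear term gives the limit, and the remainder changes the characteristic
  -- function by at most `|t| k / √n`.
  · refine ProbabilityMeasure.tendsto_iff_tendsto_charFun.2 fun t => ?_
    simp only [ProbabilityMeasure.coe_mk, Measure.map_id, charFun_gaussianReal]
    have hmain : Tendsto (fun n : ℕ =>
        charFun ((μ n).map fun ω => √(n : ℝ) * ∑ i, (phat n i ω - p i)) t) atTop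
        (𝓝 (Complex.exp (-(t ^ 2 / 2)))) := by
      refine ((Complex.continuous_exp.tendsto _).comp (tendsto_mul_exp_sub_one_sub t)).congr' ?_
      filter_upwards [eventually_ne_atTop 0] with n hn
      exact (charFun_map_sqrt_mul_sum_sub hn hp_pos hp_sum (h_law n) (h_indep n) t).symm
    have hdiff : Tendsto (fun n : ℕ =>
        charFun ((μ n).map fun ω => √(n : ℝ) * (∑ i, (phat n i ω - p i)
          + ∑ i, entropyRemainder (p i) (phat n i ω))) t
        - charFun ((μ n).map fun ω => √(n : ℝ) * ∑ i, (phat n i ω - p i)) t) atTop (𝓝 0) := by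
      refine squeeze_zero_norm' ?_ (hs.const_div_atTop (|t| * k))
      filter_upwards [eventually_ne_atTop 0] with n hn
      have hn0 : (0 : ℝ) < n := by exact_mod_cast Nat.pos_of_ne_zero hn
      simp_rw [mul_add]
      refine (norm_charFun_map_add_sub_le ((hS n).aemeasurable.const_mul _)
        (((hR n).integrable (by simp)).const_mul _) t).trans ?_
      simp_rw [abs_mul, abs_of_nonneg (Real.sqrt_nonneg _)]
      rw [integral_const_mul, mul_div_assoc]
      gcongr
      calc √(n : ℝ) * ∫ ω, |∑ i, entropyRemainder (p i) (phat n i ω)| ∂μ n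
          ≤ √n * (k / n) := by
            gcongr
            exact integral_abs_sum_entropyRemainder_le hn hp_pos (h_law n)
        _ = k / √n := by
            nth_rewrite 2 [← Real.mul_self_sqrt hn0.le]
            field_simp
    simpa using hdiff.add hmain
  · refine tendsto_mul_variance_add hS hR ?_ ?_
    · refine tendsto_const_nhds.congr' ?_
      filter_upwards [eventually_ne_atTop 0] with n hn
      rw [variance_sum_sub hn hp_pos hp_sum (h_law n) (h_indep n),
        mul_inv_cancel₀ (by exact_mod_cast hn)]
    · refine squeeze_zero' (Eventually.of_forall fun n =>
        mul_nonneg n.cast_nonneg (variance_nonneg _ _)) ?_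
        (tendsto_natCast_atTop_atTop.const_div_atTop (∑ i, (3 + (p i)⁻¹)))
      filter_upwards [eventually_ne_atTop 0] with n hn
      have hn0 : (0 : ℝ) < n := by exact_mod_cast Nat.pos_of_ne_zero hn
      calc (n : ℝ) * variance (fun ω => ∑ i, entropyRemainder (p i) (phat n i ω)) (μ n)
          ≤ n * ((∑ i, (3 + (p i)⁻¹)) / n ^ 2) := by
            gcongr
            exact variance_sum_entropyRemainder_le hn hp_pos (h_law n) (h_indep n)
        _ = (∑ i, (3 + (p i)⁻¹)) / n := by
            field_simp
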